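/- There is an absolute constant $K>0$ such that the following holds. Let $n\ge 2$ and $m$ be natural numbers, let $\mathbb F$ be any field (of any characteristic) with more than $n$ elements, and let $f_1,\dots,f_m\in\mathbb F[x_1,\dots,x_n]$ be multilinear (degree at most $1$ in each variable) and symmetric polynomials with no common Boolean solution, i.e. there is no $\mathbf a\in\{0,1\}^n$ with $f_1(\mathbf a)=\dots=f_m(\mathbf a)=0$. Then the system $f_1,\dots,f_m$ has a constant-depth-$\mathrm{IPS}_{\mathrm{LIN}}$ refutation of depth at most $8$ and size at most $K\,m^2n^5\log n$. Here an algebraic circuit over $\mathbb F$ is a finite directed acyclic graph whose leaves are variables or constants of $\mathbb F$ and whose other nodes compute a linear combination or a product of their inputs, with unbounded fan-in; its size is its number of edges, and its depth is the number of edges on a longest path from the output node to a leaf. A constant-depth-$\mathrm{IPS}_{\mathrm{LIN}}$ refutation of depth at most $8$ is an algebraic circuit $C$ over $\mathbb F$ in the variables $x_1,\dots,x_n,y_1,\dots,y_m,z_1,\dots,z_n$, of depth at most $8$ and with addition and multiplication gates alternating along every path, such that $C(\mathbf x,\mathbf 0,\mathbf 0)=0$ and $C(\mathbf x,f_1,\dots,f_m,x_1^2-x_1,\dots,x_n^2-x_n)=1$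 as polynomials, and such that the polynomial computed by $C$ has degree at most $1$ in each variable $y_j$ and in each variable $z_i$. -/

import Mathlib

/-- The label of a node of an algebraic circuit over `F` with input variables `V`, together with
its in-edges, which come from nodes of type `N` (repetitions are allowed and are separate edges). -/
inductive Gate (F V N : Type*) where
  /-- a leaf labelled by a variable -/
  | var (v : V)
  /-- a leaf labelled by a constant -/
  | const (c : F)
  /-- a linear combination of its inputs, of unbounded fan-in -/
  | sum (args : List (F × N))
  /-- a product of its inputs, of unbounded fan-in -/
  | prod (args : List N)

namespace Gate

/-- The sources of the in-edges of a gate, with multiplicity. -/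
def children {F V N : Type*} : Gate F V N → List N
  | var _ => []
  | const _ => []
  | sum args => args.map Prod.snd
  | prod args => args

/-- `g` is an addition gate. -/
def IsSum {F V N : Type*} (g : Gate F V N) : Prop := ∃ args, g = sum args

/-- `g` is a multiplication gate. -/
def IsProd {F V N : Type*} (g : Gate F V N) : Prop := ∃ args, g = prod args

/-- The polynomial computed by a gate, given the polynomials computed by the other nodes. -/
noncomputable def value {F V N : Type*} [CommSemiring F] (val : N → MvPolynomial V F) :
    Gate F V N → MvPolynomial V F
  | var v => MvPolynomial.X v
  | const c => MvPolynomial.C c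
  | sum args => (args.map fun t => MvPolynomial.C t.1 * val t.2).sum
  | prod args => (args.map val).prod

theorem value_congr {F V N : Type*} [CommSemiring F] {val val' : N → MvPolynomial V F}
    (g : Gate F V N) (h : ∀ c ∈ g.children, val c = val' c) : g.value val = g.value val' := by
  cases g with
  | var v => rfl
  | const c => rfl
  | sum args =>
    simp only [value]
    congr 1
    apply List.map_congr_left
    intro t ht
    rw [h t.2 (List.mem_map_of_mem ht)]
  | prod args =>
    simp only [value]
    congr 1
    exact List.map_congr_left h

end Gate

/-- An algebraic circuit over `F` in the variables `V`: a finite directed acyclic graph whose nodes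
are leaves (variables or constants), addition gates or multiplication gates, with an output node. -/
structure AlgebraicCircuit (F V : Type*) where
  Node : Type
  [fintypeNode : Fintype Node]
  gate : Node → Gate F V Node
  acyclic : WellFounded fun a b : Node => a ∈ (gate b).children
  output : Node

attribute [instance] AlgebraicCircuit.fintypeNode

namespace AlgebraicCircuit

open scoped Classical in
/-- The polynomial computed at a node. -/
noncomputable def nodePoly {F V : Type*} [CommSemiring F] (C : AlgebraicCircuit F V) :
    C.Node → MvPolynomial V F :=
  C.acyclic.fix fun a ih =>
    (C.gate a).value fun b => if h : b ∈ (C.gate a).children then ih b h else 0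

theorem nodePoly_eq {F V : Type*} [CommSemiring F] (C : AlgebraicCircuit F V) (a : C.Node) :
    C.nodePoly a = (C.gate a).value C.nodePoly := by
  classical
  rw [nodePoly, WellFounded.fix_eq]
  apply Gate.value_congr
  intro c hc
  simp [hc]

/-- The polynomial computed by the circuit. -/
noncomputable def poly {F V : Type*} [CommSemiring F] (C : AlgebraicCircuit F V) :
    MvPolynomial V F :=
  C.nodePoly C.output

/-- The number of edges of the circuit. -/
def size {F V : Type*} (C : AlgebraicCircuit F V) : ℕ :=
  ∑ a : C.Node, (C.gate a).children.length

/-- The number of edges on a longest path from a node down to a leaf. -/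
noncomputable def height {F V : Type*} (C : AlgebraicCircuit F V) : C.Node → ℕ :=
  C.acyclic.fix fun a ih =>
    ((C.gate a).children.attach.map fun b => ih b.1 b.2 + 1).foldr max 0

theorem height_eq {F V : Type*} (C : AlgebraicCircuit F V) (a : C.Node) :
    C.height a = ((C.gate a).children.map fun b => C.height b + 1).foldr max 0 := by
  rw [height, WellFounded.fix_eq]
  congr 1
  exact List.attach_map_val (f := fun b => C.height b + 1)

/-- The number of edges on a longest path from the output node to a leaf. -/
noncomputable def depth {F V : Type*} (C : AlgebraicCircuit F V) : ℕ := C.height C.output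

/-- Addition and multiplication gates alternate along every path. -/
def IsAlternating {F V : Type*} (C : AlgebraicCircuit F V) : Prop :=
  ∀ a : C.Node, ∀ b ∈ (C.gate a).children,
    ¬ ((C.gate a).IsSum ∧ (C.gate b).IsSum) ∧ ¬ ((C.gate a).IsProd ∧ (C.gate b).IsProd)

/-- The class of circuits with alternating gates and depth at most `d`. -/
def boundedDepth (F V : Type*) (d : ℕ) : Set (AlgebraicCircuit F V) :=
  {C | C.IsAlternating ∧ C.depth ≤ d}

end AlgebraicCircuit

/-- The polynomial `p` has individual degree at most one. -/
def IsMultilinear {F σ : Type*} [CommSemiring F] (p : MvPolynomial σ F) : Prop :=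
  ∀ i, p.degreeOf i ≤ 1

/-- Some point of the Boolean cube is a common zero of the `f j`. -/
def HasBooleanSolution {F : Type*} [Field F] {n m : ℕ}
    (f : Fin m → MvPolynomial (Fin n) F) : Prop :=
  ∃ a : Fin n → F, (∀ i, a i = 0 ∨ a i = 1) ∧ ∀ j, MvPolynomial.eval a (f j) = 0

/-- The variables `x₁, …, xₙ`, `y₁, …, yₘ`, `z₁, …, zₙ` of a refutation. -/
inductive IPSVar (n m : ℕ) where
  | x (i : Fin n)
  | y (j : Fin m)
  | z (i : Fin n)

namespace IPSVar

/-- The substitution `y ↦ 0`, `z ↦ 0`. -/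
noncomputable def zeroSubst (F : Type*) [Field F] (n m : ℕ) :
    IPSVar n m → MvPolynomial (Fin n) F
  | x i => MvPolynomial.X i
  | y _ => 0
  | z _ => 0

/-- The substitution `yⱼ ↦ fⱼ`, `zᵢ ↦ xᵢ² - xᵢ`. -/
noncomputable def axiomSubst {F : Type*} [Field F] {n m : ℕ}
    (f : Fin m → MvPolynomial (Fin n) F) : IPSVar n m → MvPolynomial (Fin n) F
  | x i => MvPolynomial.X i
  | y j => f j
  | z i => MvPolynomial.X i ^ 2 - MvPolynomial.X i

end IPSVar

/-- `C` is a refutation of the system `f`, over the Boolean cube, in the Ideal Proof System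
restricted to the class of circuits `𝒞`. -/
structure IsIPSRefutation {F : Type*} [Field F] {n m : ℕ}
    (𝒞 : Set (AlgebraicCircuit F (IPSVar n m))) (f : Fin m → MvPolynomial (Fin n) F)
    (C : AlgebraicCircuit F (IPSVar n m)) : Prop where
  mem_class : C ∈ 𝒞
  zero_subst : MvPolynomial.aeval (IPSVar.zeroSubst F n m) C.poly = 0
  axiom_subst : MvPolynomial.aeval (IPSVar.axiomSubst f) C.poly = 1

/-- An IPS refutation whose circuit has individual degree at most one in each of the variables
`y` and `z`. -/
structure IsIPSLinRefutation {F : Type*} [Field F] {n m : ℕ}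
    (𝒞 : Set (AlgebraicCircuit F (IPSVar n m))) (f : Fin m → MvPolynomial (Fin n) F)
    (C : AlgebraicCircuit F (IPSVar n m)) : Prop extends IsIPSRefutation 𝒞 f C where
  degree_y : ∀ j, C.poly.degreeOf (IPSVar.y j) ≤ 1
  degree_z : ∀ i, C.poly.degreeOf (IPSVar.z i) ≤ 1

/-! On the cube a symmetric polynomial depends only on the Hamming weight `w`. For `n + 1` distinct
field elements `u s`, the product `weightPower n (u s)` takes the value `u s ^ w`, so invertibility
of the Vandermonde matrix lets these products interpolate any function of the weight
(`exists_sum_mul_pow_eq`). Hence each `f j` is a combination of them, and so is a multiplier `g j`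
chosen so that `∑ j, g j * f j = 1` on the cube: at each weight one nonvanishing `f j` is selected,
its `g j` is the inverse value and the others vanish.

Modulo the `x i ^ 2 - x i`, a product of weight powers with bases `u`, `v` becomes the one with base
`u * v`, and the correction is a sum of explicit products of affine forms
(`weightPower_mul_sub_sum`). Subtracting the corrections from `∑ j, g j * f j` leaves a multilinear
polynomial equal to `1` on the cube, hence `1` itself. Writing `y j` for `f j` and `z i` for `x i ^
2 - x i` yields a depth-three circuit, linear in these variables. -/

namespace AlgebraicCircuit

theorem height_le_of_rank {F V : Type*} (C : AlgebraicCircuit F V) (rank : C.Node → ℕ)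
    (h : ∀ a, ∀ b ∈ (C.gate a).children, rank b < rank a) (a : C.Node) :
    C.height a ≤ rank a := by
  induction a using C.acyclic.induction with
  | _ a ih =>
    rw [height_eq]
    have key : ∀ l : List C.Node, (∀ b ∈ l, C.height b + 1 ≤ rank a) →
        (l.map fun b => C.height b + 1).foldr max 0 ≤ rank a := by
      intro l
      induction l with
      | nil => simp
      | cons b l ihl =>
        intro hl
        simp only [List.map_cons, List.foldr_cons]
        exact max_le (hl b (by simp)) (ihl fun c hc => hl c (by simp [hc]))
    exact key _ fun b hb => (Nat.succ_le_succ (ih b hb)).trans (h a b hb)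

/-! ### Sums of products of affine forms as circuits -/

section DepthThree

variable {F V : Type*} {ι κ : Type} [Fintype ι] [Fintype κ]

/-- The nodes of a sum of products of affine forms: the output, the products, the affine forms,
the variables in the affine forms, and the constant one. -/
abbrev DepthThreeNode (ι κ : Type) : Type := Unit ⊕ ι ⊕ (ι × κ) ⊕ (ι × κ) ⊕ Unit

/-- The gates of the circuit `∑ a, coeff a * ∏ k, (c + d * v)`, where `(c, d, v) = form a k`. -/
noncomputable def depthThreeGate [One F] (coeff : ι → F) (form : ι → κ → F × F × V) :
    DepthThreeNode ι κ → Gate F V (DepthThreeNode ι κ)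
  | .inl _ => .sum (Finset.univ.toList.map fun a => (coeff a, .inr (.inl a)))
  | .inr (.inl a) => .prod (Finset.univ.toList.map fun k => .inr (.inr (.inl (a, k))))
  | .inr (.inr (.inl p)) => .sum [((form p.1 p.2).1, .inr (.inr (.inr (.inr ())))),
      ((form p.1 p.2).2.1, .inr (.inr (.inr (.inl p))))]
  | .inr (.inr (.inr (.inl p))) => .var (form p.1 p.2).2.2
  | .inr (.inr (.inr (.inr _))) => .const 1

/-- The length of a longest path below a node of a sum of products of affine forms. -/
def depthThreeRank : DepthThreeNode ι κ → ℕ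
  | .inl _ => 3
  | .inr (.inl _) => 2
  | .inr (.inr (.inl _)) => 1
  | .inr (.inr (.inr _)) => 0

theorem depthThreeRank_lt [One F] (coeff : ι → F) (form : ι → κ → F × F × V)
    (a b : DepthThreeNode ι κ) (h : b ∈ (depthThreeGate coeff form a).children) :
    depthThreeRank b < depthThreeRank a := by
  rcases a with _ | a | p | p | _ <;>
    simp only [depthThreeGate, Gate.children, List.map_map, List.mem_map, List.map_cons,
      List.map_nil, List.mem_cons, List.not_mem_nil, or_false, Function.comp] at h
  · obtain ⟨a, -, rfl⟩ := h
    simp [depthThreeRank]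
  · obtain ⟨a, -, rfl⟩ := h
    simp [depthThreeRank]
  · rcases h with rfl | rfl <;> simp [depthThreeRank]

/-- The circuit `∑ a, coeff a * ∏ k, (c + d * v)`, where `(c, d, v) = form a k`. -/
noncomputable def depthThree [One F] (coeff : ι → F) (form : ι → κ → F × F × V) :
    AlgebraicCircuit F V where
  Node := DepthThreeNode ι κ
  gate := depthThreeGate coeff form
  acyclic := Subrelation.wf (fun {a b} h => depthThreeRank_lt coeff form b a h)
    (measure depthThreeRank).wf
  output := .inl ()

theorem depthThree_mem_boundedDepth [One F] (coeff : ι → F) (form : ι → κ → F × F × V) :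
    depthThree coeff form ∈ boundedDepth F V 3 := by
  refine ⟨?_, height_le_of_rank (depthThree coeff form) depthThreeRank
    (depthThreeRank_lt coeff form) (.inl ())⟩
  intro (a : DepthThreeNode ι κ) (b : DepthThreeNode ι κ) h
  change b ∈ (depthThreeGate coeff form a).children at h
  change ¬ ((depthThreeGate coeff form a).IsSum ∧ (depthThreeGate coeff form b).IsSum) ∧
    ¬ ((depthThreeGate coeff form a).IsProd ∧ (depthThreeGate coeff form b).IsProd)
  rcases a with _ | a | p | p | _ <;>
    simp only [depthThreeGate, Gate.children, List.map_map, List.mem_map, List.map_cons,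
      List.map_nil, List.mem_cons, List.not_mem_nil, or_false, Function.comp] at h
  · obtain ⟨a, -, rfl⟩ := h
    simp [depthThreeGate, Gate.IsSum, Gate.IsProd]
  · obtain ⟨a, -, rfl⟩ := h
    simp [depthThreeGate, Gate.IsSum, Gate.IsProd]
  · rcases h with rfl | rfl <;> simp [depthThreeGate, Gate.IsSum, Gate.IsProd]

theorem size_depthThree [One F] (coeff : ι → F) (form : ι → κ → F × F × V) :
    (depthThree coeff form).size = Fintype.card ι * (1 + 3 * Fintype.card κ) := by
  change ∑ a : DepthThreeNode ι κ, (depthThreeGate coeff form a).children.length = _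
  simp [Fintype.sum_sum_type, depthThreeGate, Gate.children]
  ring

theorem poly_depthThree [CommSemiring F] (coeff : ι → F) (form : ι → κ → F × F × V) :
    (depthThree coeff form).poly = ∑ a, MvPolynomial.C (coeff a) *
      ∏ k, (MvPolynomial.C (form a k).1 +
        MvPolynomial.C (form a k).2.1 * MvPolynomial.X (form a k).2.2) := by
  obtain ⟨val, hval, hout⟩ : ∃ val : DepthThreeNode ι κ → MvPolynomial V F,
      (∀ a, val a = (depthThreeGate coeff form a).value val) ∧
        (depthThree coeff form).poly = val (.inl ()) :=
    ⟨_, (depthThree coeff form).nodePoly_eq, rfl⟩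
  have hone : val (.inr (.inr (.inr (.inr ())))) = 1 := by
    rw [hval]; simp [depthThreeGate, Gate.value]
  have hvar (p : ι × κ) : val (.inr (.inr (.inr (.inl p)))) =
      MvPolynomial.X (form p.1 p.2).2.2 := by
    rw [hval]; simp [depthThreeGate, Gate.value]
  have hform (p : ι × κ) : val (.inr (.inr (.inl p))) =
      MvPolynomial.C (form p.1 p.2).1 +
        MvPolynomial.C (form p.1 p.2).2.1 * MvPolynomial.X (form p.1 p.2).2.2 := by
    rw [hval]; simp [depthThreeGate, Gate.value, hone, hvar]
  have hprod (a : ι) : val (.inr (.inl a)) = ∏ k, (MvPolynomial.C (form a k).1 +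
        MvPolynomial.C (form a k).2.1 * MvPolynomial.X (form a k).2.2) := by
    rw [hval]
    simp only [depthThreeGate, Gate.value, List.map_map, Function.comp_def, hform]
    exact Finset.prod_map_toList _ _
  rw [hout, hval]
  simp only [depthThreeGate, Gate.value, List.map_map, Function.comp_def, hprod]
  exact Finset.sum_map_toList _ _

end DepthThree

end AlgebraicCircuit

namespace MvPolynomial

theorem degreeOf_affine_le {F σ : Type*} [CommSemiring F] [Nontrivial F] [DecidableEq σ] (c d : F) (v w : σ) :
    (C c + C d * X w : MvPolynomial σ F).degreeOf v ≤ if v = w then 1 else 0 := by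
  refine (degreeOf_add_le _ _ _).trans (max_le (by simp) ((degreeOf_C_mul_le _ _ _).trans ?_))
  rw [degreeOf_X]

end MvPolynomial

/-! ### Symmetric multilinear polynomials on the Boolean cube -/

section Cube

open MvPolynomial

/-- The Boolean point with support `T`. -/
def cubePoint (F : Type*) [Field F] {n : ℕ} (T : Finset (Fin n)) (i : Fin n) : F :=
  if i ∈ T then 1 else 0

theorem cubePoint_eq_zero_or_one (F : Type*) [Field F] {n : ℕ} (T : Finset (Fin n)) (i : Fin n) :
    cubePoint F T i = 0 ∨ cubePoint F T i = 1 := by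
  unfold cubePoint
  split_ifs <;> simp

theorem IsMultilinear.eq_of_eval_cubePoint {F : Type*} [Field F] {n : ℕ}
    {p q : MvPolynomial (Fin n) F} (hp : IsMultilinear p) (hq : IsMultilinear q)
    (h : ∀ T, eval (cubePoint F T) p = eval (cubePoint F T) q) : p = q := by
  classical
  rw [← sub_eq_zero]
  refine eq_zero_of_eval_zero_at_prod_finset _ (fun _ => {0, 1}) (fun i => ?_) fun a ha => ?_
  · rw [Finset.card_pair zero_ne_one]
    exact Nat.lt_succ_of_le ((degreeOf_sub_le _ _ _).trans (max_le (hp i) (hq i)))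
  · have : a = cubePoint F (Finset.univ.filter fun i => a i = 1) := by
      funext i
      have := ha i
      simp only [Finset.mem_insert, Finset.mem_singleton] at this
      rcases this with h0 | h1 <;> simp [cubePoint, *]
    rw [this, map_sub, h, sub_self]

/-- A bijection between the supports extends to a permutation of the variables. -/
theorem eval_cubePoint_eq_of_card_eq {F : Type*} [Field F] {n : ℕ}
    {p : MvPolynomial (Fin n) F} (hp : p.IsSymmetric) {S T : Finset (Fin n)}
    (h : S.card = T.card) : eval (cubePoint F S) p = eval (cubePoint F T) p := by
  classical
  let e : {i // i ∈ T} ≃ {i // i ∈ S} := Fintype.equivOfCardEq (by simp [h])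
  have hp' := hp e.extendSubtype
  conv_lhs => rw [← hp', eval_rename]
  congr 2
  funext i
  by_cases hi : i ∈ T
  · have := e.extendSubtype_mem i hi
    simp [cubePoint, hi, this]
  · have := e.extendSubtype_not_mem i hi
    simp [cubePoint, hi, this]

/-- The product of the affine forms `1 + (u - 1) * xₖ`, whose value at a Boolean point of
weight `w` is `u ^ w`. -/
noncomputable def weightPower {F : Type*} [Field F] (n : ℕ) (u : F) : MvPolynomial (Fin n) F :=
  ∏ k, (1 + C (u - 1) * X k)

theorem eval_cubePoint_weightPower {F : Type*} [Field F] {n : ℕ} (u : F) (T : Finset (Fin n)) :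
    eval (cubePoint F T) (weightPower n u) = u ^ T.card := by
  classical
  rw [weightPower, map_prod, ← Finset.prod_const, ← Finset.prod_subset T.subset_univ]
  · refine Finset.prod_congr rfl fun i hi => ?_
    simp [cubePoint, hi]
  · intro i _ hi
    simp [cubePoint, hi]

theorem isMultilinear_weightPower {F : Type*} [Field F] {n : ℕ} (u : F) :
    IsMultilinear (weightPower n u) := by
  classical
  intro i
  refine (degreeOf_prod_le _ _ _).trans ?_
  refine (Finset.sum_le_sum fun k _ => by simpa using degreeOf_affine_le 1 (u - 1) i k).trans ?_
  simp

theorem isMultilinear_sum_C_mul {F ι : Type*} [Field F] {n : ℕ} (s : Finset ι) (c : ι → F)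
    {p : ι → MvPolynomial (Fin n) F} (h : ∀ a, IsMultilinear (p a)) :
    IsMultilinear (∑ a ∈ s, C (c a) * p a) := fun i =>
  (degreeOf_sum_le _ _ _).trans <| Finset.sup_le fun a _ =>
    (degreeOf_C_mul_le _ _ _).trans (h a i)

/-- Values at the weights `0, …, n` are attained by a combination of powers of `n + 1` distinct
bases. -/
theorem exists_sum_mul_pow_eq {F : Type*} [Field F] {n : ℕ} {u : Fin (n + 1) → F}
    (hu : Function.Injective u) (v : Fin (n + 1) → F) :
    ∃ c : Fin (n + 1) → F, ∀ w : Fin (n + 1), ∑ s, c s * u s ^ (w : ℕ) = v w := by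
  have hdet : IsUnit (Matrix.vandermonde u).det :=
    isUnit_iff_ne_zero.2 (Matrix.det_vandermonde_ne_zero_iff.2 hu)
  refine ⟨Matrix.vecMul v (Matrix.vandermonde u)⁻¹, fun w => ?_⟩
  have : Matrix.vecMul (Matrix.vecMul v (Matrix.vandermonde u)⁻¹) (Matrix.vandermonde u) = v := by
    rw [Matrix.vecMul_vecMul, Matrix.nonsing_inv_mul _ hdet, Matrix.vecMul_one]
  simpa [Matrix.vecMul, dotProduct, Matrix.vandermonde] using congrFun this w

/-- Multiplying two weight powers and reducing each variable separately modulo `xᵢ² - xᵢ`. -/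
theorem weightPower_mul_sub_sum {F : Type*} [Field F] {n : ℕ} (u v : F) :
    weightPower n u * weightPower n v - ∑ i : Fin n, C ((u - 1) * (v - 1)) * ((X i ^ 2 - X i) *
      ((∏ k with k < i, (1 + C (u * v - 1) * X k)) *
        ∏ k with i < k, (1 + C (u - 1) * X k) * (1 + C (v - 1) * X k))) =
      weightPower n (u * v) := by
  -- Telescoping: factors before `i` are already reduced, those after `i` are not.
  have key := Finset.prod_sub_ordered (Finset.univ : Finset (Fin n))
    (fun k => ((1 + C (u - 1) * X k) * (1 + C (v - 1) * X k) : MvPolynomial (Fin n) F))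
    (fun k => C ((u - 1) * (v - 1)) * (X k ^ 2 - X k))
  have hsub (k : Fin n) : ((1 + C (u - 1) * X k) * (1 + C (v - 1) * X k) -
      C ((u - 1) * (v - 1)) * (X k ^ 2 - X k) : MvPolynomial (Fin n) F) =
      1 + C (u * v - 1) * X k := by
    simp only [C_mul, C_sub, C_1]
    ring
  simp only [hsub] at key
  rw [weightPower, weightPower, weightPower, key, Finset.prod_mul_distrib]
  refine congrArg _ (Finset.sum_congr rfl fun i _ => ?_)
  rw [mul_assoc, mul_assoc]

end Cube

/-! ### The refutation, its correctness and its size -/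

section Refutation

open MvPolynomial

variable {F : Type*} [Field F] {n m : ℕ}

/-- The index type of the summands of the refutation: multiples of `yⱼ`, then multiples of
`zᵢ`. -/
abbrev RefutationIndex (n m : ℕ) : Type :=
  (Fin m × Fin (n + 1)) ⊕ (Fin n × Fin (n + 1) × Fin (n + 1))

/-- The coefficients of the summands of the refutation. -/
def refutationCoeff (u : Fin (n + 1) → F) (α β : Fin m → Fin (n + 1) → F) :
    RefutationIndex n m → F
  | .inl (j, s) => α j s
  | .inr (_, s, t) => -(∑ j, α j s * β j t) * ((u s - 1) * (u t - 1))

/-- The affine forms in the summands of the refutation. -/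
def refutationForm (u : Fin (n + 1) → F) :
    RefutationIndex n m → Option (Fin n ⊕ Fin n) → F × F × IPSVar n m
  | .inl (j, _), none => (0, 1, .y j)
  | .inl (_, s), some (.inl k) => (1, u s - 1, .x k)
  -- Padding by the constant form `1` gives all summands the same number of factors.
  | .inl _, some (.inr k) => (1, 0, .x k)
  | .inr (i, _, _), none => (0, 1, .z i)
  | .inr (i, s, t), some (.inl k) =>
      (1, if k < i then u s * u t - 1 else if i < k then u s - 1 else 0, .x k)
  | .inr (i, _, t), some (.inr k) => (1, if i < k then u t - 1 else 0, .x k)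

/-- The depth-three refutation. -/
noncomputable def refutationCircuit (u : Fin (n + 1) → F) (α β : Fin m → Fin (n + 1) → F) :
    AlgebraicCircuit F (IPSVar n m) :=
  .depthThree (refutationCoeff u α β) (refutationForm u)

theorem aeval_poly_refutationCircuit (u : Fin (n + 1) → F) (α β : Fin m → Fin (n + 1) → F)
    (φ : IPSVar n m → MvPolynomial (Fin n) F) (hx : ∀ k, φ (.x k) = X k) :
    aeval φ (refutationCircuit u α β).poly =
      ∑ j, ∑ s, C (α j s) * (φ (.y j) * weightPower n (u s)) +
      ∑ i, ∑ s, ∑ t, C (-(∑ j, α j s * β j t) * ((u s - 1) * (u t - 1))) *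
        (φ (.z i) * ((∏ k with k < i, (1 + C (u s * u t - 1) * X k)) *
          ∏ k with i < k, (1 + C (u s - 1) * X k) * (1 + C (u t - 1) * X k))) := by
  rw [refutationCircuit, AlgebraicCircuit.poly_depthThree]
  simp only [map_sum, map_mul (aeval φ), map_prod, map_add (aeval φ), algHom_C, aeval_X,
    algebraMap_eq]
  rw [Fintype.sum_sum_type]
  simp only [Fintype.sum_prod_type, Fintype.prod_option, Fintype.prod_sum_type, refutationForm,
    refutationCoeff, hx, C_0, C_1, zero_add, zero_mul, add_zero, Finset.prod_const_one, mul_one,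
    one_mul]
  refine congrArg _ <| Finset.sum_congr rfl fun i _ => Finset.sum_congr rfl fun s _ =>
    Finset.sum_congr rfl fun t _ => ?_
  refine congrArg _ (congrArg _ ?_)
  rw [← Finset.prod_mul_distrib, Finset.prod_filter, Finset.prod_filter,
    ← Finset.prod_mul_distrib]
  refine Finset.prod_congr rfl fun k _ => ?_
  rcases lt_trichotomy k i with h | rfl | h
  · simp [h, h.not_gt]
  · simp
  · simp [h, h.not_gt]

/-- In each summand only the form at `none` involves a variable other than the `x k`. -/
theorem degreeOf_poly_refutationCircuit_le (u : Fin (n + 1) → F) (α β : Fin m → Fin (n + 1) → F)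
    {v : IPSVar n m} (hv : ∀ k, v ≠ .x k) :
    (refutationCircuit u α β).poly.degreeOf v ≤ 1 := by
  classical
  rw [refutationCircuit, AlgebraicCircuit.poly_depthThree]
  refine (degreeOf_sum_le _ _ _).trans <| Finset.sup_le fun a _ =>
    (degreeOf_C_mul_le _ _ _).trans <| (degreeOf_prod_le _ _ _).trans <|
    (Finset.sum_le_sum fun k _ => degreeOf_affine_le _ _ _ _).trans ?_
  rcases a with ⟨j, s⟩ | ⟨i, s, t⟩
  · simp only [Fintype.sum_option, Fintype.sum_sum_type, refutationForm, hv, if_false,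
      Finset.sum_const_zero, add_zero]
    by_cases h : v = .y j <;> simp [h]
  · simp only [Fintype.sum_option, Fintype.sum_sum_type, refutationForm, hv, if_false,
      Finset.sum_const_zero, add_zero]
    by_cases h : v = .z i <;> simp [h]

theorem axiomSubst_refutationCircuit {f : Fin m → MvPolynomial (Fin n) F}
    {u : Fin (n + 1) → F} {α β : Fin m → Fin (n + 1) → F}
    (hf : ∀ j, f j = ∑ t, C (β j t) * weightPower n (u t))
    (hαβ : ∀ w : Fin (n + 1),
      ∑ j, (∑ s, α j s * u s ^ (w : ℕ)) * (∑ t, β j t * u t ^ (w : ℕ)) = 1) :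
    aeval (IPSVar.axiomSubst f) (refutationCircuit u α β).poly = 1 := by
  -- The `z` terms are exactly the corrections that reduce every product of two weight powers.
  have hred : aeval (IPSVar.axiomSubst f) (refutationCircuit u α β).poly =
      ∑ p : Fin (n + 1) × Fin (n + 1), C (∑ j, α j p.1 * β j p.2) *
        weightPower n (u p.1 * u p.2) := by
    rw [aeval_poly_refutationCircuit _ _ _ _ fun _ => rfl, Fintype.sum_prod_type]
    simp only [← weightPower_mul_sub_sum, mul_sub (C _), Finset.sum_sub_distrib]
    rw [sub_eq_add_neg]
    congr 1
    · simp only [IPSVar.axiomSubst, hf, map_sum, C_mul, Finset.sum_mul, Finset.mul_sum]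
      refine Finset.sum_comm.trans (Finset.sum_congr rfl fun s _ => ?_)
      refine Finset.sum_comm.trans ?_
      exact Finset.sum_congr rfl fun t _ => Finset.sum_congr rfl fun j _ => by ring
    · rw [← Finset.sum_neg_distrib]
      refine Finset.sum_comm.trans (Finset.sum_congr rfl fun s _ => ?_)
      rw [← Finset.sum_neg_distrib]
      refine Finset.sum_comm.trans ?_
      refine Finset.sum_congr rfl fun t _ => ?_
      rw [Finset.mul_sum]
      refine (Finset.sum_congr rfl fun i _ => ?_).trans (Finset.sum_neg_distrib _)
      simp only [IPSVar.axiomSubst, C_mul, C_neg]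
      ring
  rw [hred]
  refine (isMultilinear_sum_C_mul _ _ fun _ => isMultilinear_weightPower _).eq_of_eval_cubePoint
    (fun i => (degreeOf_C (1 : F) i).le.trans zero_le_one) fun T => ?_
  have hT : T.card < n + 1 := Nat.lt_succ_of_le (by simpa using T.card_le_univ)
  rw [map_one, ← hαβ ⟨T.card, hT⟩, map_sum, Fintype.sum_prod_type]
  simp only [map_mul, eval_C, eval_cubePoint_weightPower, Finset.sum_mul,
    Finset.mul_sum, mul_pow]
  refine Finset.sum_comm.trans (Eq.symm ?_)
  refine Finset.sum_comm.trans (Finset.sum_congr rfl fun s _ => ?_)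
  refine Finset.sum_comm.trans ?_
  exact Finset.sum_congr rfl fun t _ =>
    Finset.sum_congr rfl fun j _ => by ring

theorem exists_refutationCircuit {f : Fin m → MvPolynomial (Fin n) F}
    (hcard : (n : ℕ∞) < ENat.card F) (hlin : ∀ j, IsMultilinear (f j))
    (hsymm : ∀ j, (f j).IsSymmetric) (hsol : ¬ HasBooleanSolution f) :
    ∃ (u : Fin (n + 1) → F) (α β : Fin m → Fin (n + 1) → F),
      IsIPSLinRefutation (AlgebraicCircuit.boundedDepth F (IPSVar n m) 8) f
        (refutationCircuit u α β) := by
  classical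
  obtain ⟨u, hu⟩ : ∃ u : Fin (n + 1) → F, Function.Injective u := by
    rcases finite_or_infinite F with h | h
    · have := Fintype.ofFinite F
      rw [ENat.card_eq_coe_fintype_card, Nat.cast_lt] at hcard
      obtain ⟨e⟩ := Function.Embedding.nonempty_of_card_le (α := Fin (n + 1)) (β := F)
        (by simpa using hcard)
      exact ⟨e, e.injective⟩
    · exact ⟨fun s => Infinite.natEmbedding F s,
        (Infinite.natEmbedding F).injective.comp Fin.val_injective⟩
  -- An initial segment serves as the representative of weight `w`.
  let pt (w : Fin (n + 1)) : Finset (Fin n) := Finset.univ.filter fun i => (i : ℕ) < w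
  have hpt (T : Finset (Fin n)) (w : Fin (n + 1)) (h : T.card = w) : T.card = (pt w).card := by
    rw [h, Fin.card_filter_val_lt, min_eq_right (Nat.le_of_lt_succ w.isLt)]
  have hex (w : Fin (n + 1)) : ∃ j, eval (cubePoint F (pt w)) (f j) ≠ 0 := by
    by_contra! h
    exact hsol ⟨_, cubePoint_eq_zero_or_one F (pt w), h⟩
  choose sel hsel using hex
  choose β hβ using fun j => exists_sum_mul_pow_eq hu fun w => eval (cubePoint F (pt w)) (f j)
  choose α hα using fun j => exists_sum_mul_pow_eq hu fun w =>
    if j = sel w then (eval (cubePoint F (pt w)) (f j))⁻¹ else 0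
  have hf (j : Fin m) : f j = ∑ t, C (β j t) * weightPower n (u t) := by
    refine (hlin j).eq_of_eval_cubePoint
      (isMultilinear_sum_C_mul _ _ fun _ => isMultilinear_weightPower _) fun T => ?_
    have hT : T.card < n + 1 := Nat.lt_succ_of_le (by simpa using T.card_le_univ)
    rw [eval_cubePoint_eq_of_card_eq (hsymm j) (hpt T ⟨T.card, hT⟩ rfl), ← hβ]
    simp [eval_cubePoint_weightPower]
  refine ⟨u, α, β, ⟨⟨?_, ?_, axiomSubst_refutationCircuit hf fun w => ?_⟩, fun j => ?_,
    fun i => ?_⟩⟩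
  · have := AlgebraicCircuit.depthThree_mem_boundedDepth (refutationCoeff u α β)
      (refutationForm u)
    exact ⟨this.1, this.2.trans (by norm_num)⟩
  · rw [aeval_poly_refutationCircuit _ _ _ _ fun _ => rfl]
    simp [IPSVar.zeroSubst]
  · simp only [hα, hβ, ite_mul, zero_mul, Finset.sum_ite_eq', Finset.mem_univ, if_true]
    exact inv_mul_cancel₀ (hsel w)
  · exact degreeOf_poly_refutationCircuit_le _ _ _ (by simp)
  · exact degreeOf_poly_refutationCircuit_le _ _ _ (by simp)

theorem size_refutationCircuit_le (u : Fin (n + 1) → F) (α β : Fin m → Fin (n + 1) → F)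
    (hn : 2 ≤ n) (hm : 1 ≤ m) :
    ((refutationCircuit u α β).size : ℝ) ≤
      48 * ((m : ℝ) ^ 2 * (n : ℝ) ^ 5 * Real.log n) := by
  have hsize : (refutationCircuit u α β).size =
      (m * (n + 1) + n * ((n + 1) * (n + 1))) * (1 + 3 * (n + n + 1)) := by
    rw [refutationCircuit, AlgebraicCircuit.size_depthThree]
    simp
  have hnat : (refutationCircuit u α β).size ≤ 24 * (m ^ 2 * n ^ 5) := by
    rw [hsize]
    have h1 : n + 1 ≤ 2 * n := by omega
    -- The size is at most `16 m n² + 32 n⁴`, so there is room to spare; `h2` and `h3` absorb the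
    -- two terms.
    have h2 : m * n ^ 2 * 2 ^ 3 ≤ m ^ 2 * n ^ 5 := by
      calc m * n ^ 2 * 2 ^ 3 ≤ m * n ^ 2 * n ^ 3 * m := by
            refine (Nat.mul_le_mul_left _ (Nat.pow_le_pow_left hn 3)).trans ?_
            exact Nat.le_mul_of_pos_right _ hm
        _ = m ^ 2 * n ^ 5 := by ring
    have h3 : n ^ 4 * 2 ≤ m ^ 2 * n ^ 5 := by
      calc n ^ 4 * 2 ≤ n ^ 4 * n * m ^ 2 := by
            refine (Nat.mul_le_mul_left _ hn).trans ?_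
            exact Nat.le_mul_of_pos_right _ (by positivity)
        _ = m ^ 2 * n ^ 5 := by ring
    calc (m * (n + 1) + n * ((n + 1) * (n + 1))) * (1 + 3 * (n + n + 1))
        ≤ (m * (2 * n) + n * ((2 * n) * (2 * n))) * (8 * n) := by gcongr; omega
      _ = 16 * (m * n ^ 2) + 32 * n ^ 4 := by ring
      _ ≤ 24 * (m ^ 2 * n ^ 5) := by omega
  have hlog : (1 : ℝ) / 2 ≤ Real.log n := by
    have h2 : Real.log 2 ≤ Real.log n :=
      Real.log_le_log (by norm_num) (by exact_mod_cast hn)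
    linarith [Real.log_two_gt_d9]
  calc ((refutationCircuit u α β).size : ℝ) ≤ 24 * ((m : ℝ) ^ 2 * (n : ℝ) ^ 5) := by
        exact_mod_cast hnat
    _ = 48 * ((m : ℝ) ^ 2 * (n : ℝ) ^ 5 * (1 / 2)) := by ring
    _ ≤ 48 * ((m : ℝ) ^ 2 * (n : ℝ) ^ 5 * Real.log n) := by gcongr

end Refutation

theorem mainTheorem8 :
    ∃ K : ℝ, 0 < K ∧
      ∀ (F : Type*) [Field F] (n m : ℕ), 2 ≤ n → (n : ℕ∞) < ENat.card F →
        ∀ f : Fin m → MvPolynomial (Fin n) F,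
          (∀ j, IsMultilinear (f j)) → (∀ j, (f j).IsSymmetric) → ¬ HasBooleanSolution f →
            ∃ C : AlgebraicCircuit F (IPSVar n m),
              IsIPSLinRefutation (AlgebraicCircuit.boundedDepth F (IPSVar n m) 8) f C ∧
                (C.size : ℝ) ≤ K * ((m : ℝ) ^ 2 * (n : ℝ) ^ 5 * Real.log n) := by
  refine ⟨48, by norm_num, fun F _ n m hn hcard f hlin hsymm hsol => ?_⟩
  obtain ⟨u, α, β, h⟩ := exists_refutationCircuit hcard hlin hsymm hsol
  -- For `m = 0` every Boolean point is vacuously a solution.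
  have hm : 1 ≤ m := by
    by_contra hm
    obtain rfl : m = 0 := by omega
    exact hsol ⟨0, fun _ => .inl rfl, fun j => j.elim0⟩
  exact ⟨_, h, size_refutationCircuit_le u α β hn hm⟩
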